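/- Let $\mathcal A$ be a unital $C^*$-algebra and let $H_{\mathcal A}$ be the standard Hilbert $\mathcal A$-module, i.e. the module of all sequences $(x_n)_{n\in\mathbb N}$ in $\mathcal A$ for which $\sum_n\langle x_n,x_n\rangle$ converges in norm, with inner product $\langle x,y\rangle=\sum_n\langle x_n,y_n\rangle$, where $\langle a,b\rangle=ba^*$ for $a,b\in\mathcal A$ (modules are written as left modules). Let $F$ be a bounded adjointable $\mathcal A$-linear operator on $H_{\mathcal A}$. An $\mathcal M\Phi_+$ decomposition for $F$ consists of closed submodules $M_1,N_1,M_2,N_2$ of $H_{\mathcal A}$ such that $N_1$ is finitely generated, $H_{\mathcal A}=M_1\tilde\oplus N_1=M_2\tilde\oplus N_2$ (direct, not necessarily orthogonal, sums), $F(M_1)\subseteq M_2$, $F(N_1)\subseteq N_2$, and the restriction $F|_{M_1}:M_1\to M_2$ is an isomorphism. The operator $F$ belongs to $\mathcal M\Phi_+(H_{\mathcal A})$ if it has an $\mathcal M\Phi_+$ decomposition. Let $K(\mathcal A)$ be the Grothendieck group of the monoid, under direct sum, of isomorphism classes of finitely generated projective $\mathcal A$-modules, and write $[N]$ for the class of such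 a module $N$. Lemma 2.20. Let $F\in\mathcal M\Phi_+(H_{\mathcal A})$ and suppose that $\operatorname{ran}F$ is closed. If $$H_{\mathcal A}=M_1\tilde\oplus N_1\xrightarrow{\;F\;}M_2\tilde\oplus N_2=H_{\mathcal A},\qquad H_{\mathcal A}=M_1'\tilde\oplus N_1'\xrightarrow{\;F\;}M_2'\tilde\oplus N_2'=H_{\mathcal A}$$ are two $\mathcal M\Phi_+$ decompositions for $F$, then $F(N_1)$ and $F(N_1')$ are closed, finitely generated and projective $\mathcal A$-modules, $N_1$ and $N_1'$ are finitely generated and projective as well, and $$[N_1]-[F(N_1)]=[N_1']-[F(N_1')]\quad\text{in }K(\mathcal A).$$ -/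

import Mathlib

universe u

namespace HilbertModule

open scoped InnerProductSpace

/-! ### The standard module `H_A` over a unital C⋆-algebra -/

section StandardModule

variable {A : Type u} [CStarAlgebra A] [PartialOrder A] [StarOrderedRing A]

/-- The Cauchy-Schwarz inequality for finite sums in `A`. -/
theorem norm_sum_mul_star_le (x y : ℕ → A) (t : Finset ℕ) :
    ‖∑ n ∈ t, y n * star (x n)‖ ≤
      √‖∑ n ∈ t, x n * star (x n)‖ * √‖∑ n ∈ t, y n * star (y n)‖ := by
  have h := CStarModule.norm_inner_le (A := A) (WithCStarModule A ((i : t) → A))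
    (x := (WithCStarModule.equiv A ((i : t) → A)).symm fun i => x i)
    (y := (WithCStarModule.equiv A ((i : t) → A)).symm fun i => y i)
  simp only [WithCStarModule.pi_norm, WithCStarModule.pi_inner,
    WithCStarModule.equiv_symm_pi_apply, WithCStarModule.inner_def] at h
  rw [Finset.sum_coe_sort t (fun n => y n * star (x n)),
    Finset.sum_coe_sort t (fun n => x n * star (x n)),
    Finset.sum_coe_sort t (fun n => y n * star (y n))] at h
  exact h

theorem summable_mul_star {x y : ℕ → A} (hx : Summable fun n => x n * star (x n))
    (hy : Summable fun n => y n * star (y n)) : Summable fun n => y n * star (x n) := by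
  rw [summable_iff_vanishing_norm] at hx hy ⊢
  intro ε hε
  obtain ⟨s, hs⟩ := hx ε hε
  obtain ⟨s', hs'⟩ := hy ε hε
  refine ⟨s ∪ s', fun t ht => ?_⟩
  rw [Finset.disjoint_union_right] at ht
  have h1 := Real.sqrt_lt_sqrt (norm_nonneg _) (hs t ht.1)
  have h2 := Real.sqrt_lt_sqrt (norm_nonneg _) (hs' t ht.2)
  calc _ ≤ _ := norm_sum_mul_star_le x y t
    _ < √ε * √ε := mul_lt_mul'' h1 h2 (Real.sqrt_nonneg _) (Real.sqrt_nonneg _)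
    _ = ε := Real.mul_self_sqrt hε.le

variable (A) in
/-- The sequences `(xₙ)` in `A` for which `∑ xₙ xₙ⋆` converges in norm. -/
def squareSummable : Submodule A (ℕ → A) where
  carrier := {x | Summable fun n => x n * star (x n)}
  zero_mem' := by simp [summable_zero]
  add_mem' {x y} hx hy := by
    have h := ((show Summable fun n => x n * star (x n) from hx).add (summable_mul_star hy hx)).add
      ((summable_mul_star hx hy).add (show Summable fun n => y n * star (y n) from hy))
    refine h.congr fun n => ?_
    simp only [Pi.add_apply, star_add]
    noncomm_ring
  smul_mem' a x hx := by
    have h := ((show Summable fun n => x n * star (x n) from hx).mul_left a).mul_right (star a)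
    refine h.congr fun n => ?_
    simp [mul_assoc]

variable (A) in
/-- The standard module `H_A`: the Hilbert C⋆-module of all sequences `(xₙ)` in `A` for which
`∑ xₙ xₙ⋆` converges in norm, with the inner product `⟪x, y⟫ = ∑ yₙ xₙ⋆`
(Mathlib's convention: left modules, inner product linear in the second variable). -/
def StandardModule : Type u := squareSummable A

namespace StandardModule

noncomputable instance : AddCommGroup (StandardModule A) :=
  inferInstanceAs (AddCommGroup (squareSummable A))

noncomputable instance : Module A (StandardModule A) :=
  inferInstanceAs (Module A (squareSummable A))

noncomputable instance : Module ℂ (StandardModule A) :=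
  inferInstanceAs (Module ℂ (squareSummable A))

instance : IsScalarTower ℂ A (StandardModule A) :=
  inferInstanceAs (IsScalarTower ℂ A (squareSummable A))

instance : CoeFun (StandardModule A) (fun _ => ℕ → A) := ⟨fun x => x.1⟩

theorem summable (x y : StandardModule A) : Summable fun n => y n * star (x n) :=
  summable_mul_star x.2 y.2

noncomputable instance : Norm (StandardModule A) :=
  ⟨fun x => √‖∑' n, x n * star (x n)‖⟩

noncomputable instance : CStarModule A (StandardModule A) where
  inner x y := ∑' n, y n * star (x n)
  inner_add_right {x y z} := by
    rw [← (summable x y).tsum_add (summable x z)]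
    exact tsum_congr fun n => add_mul _ _ _
  inner_self_nonneg {x} := tsum_nonneg fun n => mul_star_self_nonneg _
  inner_self {x} := by
    constructor
    · intro h
      have h0 := (hasSum_zero_iff_of_nonneg fun n => mul_star_self_nonneg (x n)).1
        (h ▸ (summable x x).hasSum)
      refine Subtype.ext (funext fun n => ?_)
      exact CStarRing.mul_star_self_eq_zero_iff _ |>.1 (congrFun h0 n)
    · rintro rfl
      have : ∀ n, (0 : StandardModule A) n = 0 := fun n => rfl
      simp [this]
  inner_op_smul_right {a x y} := by
    rw [← (summable x y).tsum_mul_left a]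
    exact tsum_congr fun n => mul_assoc _ _ _
  inner_smul_right_complex {z x y} := by
    rw [← (summable x y).tsum_const_smul z]
    exact tsum_congr fun n => smul_mul_assoc _ _ _
  star_inner x y := by
    rw [tsum_star]
    exact tsum_congr fun n => by simp
  norm_eq_sqrt_norm_inner_self _ := rfl

noncomputable instance : NormedAddCommGroup (StandardModule A) :=
  CStarModule.normedAddCommGroup A

noncomputable instance : NormedSpace ℂ (StandardModule A) :=
  NormedSpace.ofCore (CStarModule.normedSpaceCore A)

end StandardModule

end StandardModule

/-! ### The `K`-group of finitely generated projective modules -/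

section KGroup

/-- `M` is a finitely generated projective `A`-module. -/
structure IsFGProjective (A : Type u) [Ring A] (M : Type u) [AddCommGroup M] [Module A M] :
    Prop where
  finite : Module.Finite A M
  projective : Module.Projective A M

variable (A : Type u) [Ring A]

/-- A bundled finitely generated projective `A`-module. -/
structure FGProjModule where
  carrier : Type u
  [addCommGroup : AddCommGroup carrier]
  [module : Module A carrier]
  [finite : Module.Finite A carrier]
  [projective : Module.Projective A carrier]

attribute [instance] FGProjModule.addCommGroup FGProjModule.module FGProjModule.finite
  FGProjModule.projective

/-- Isomorphism of finitely generated projective modules. -/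
instance FGProjModule.setoid : Setoid (FGProjModule A) where
  r P Q := Nonempty (P.carrier ≃ₗ[A] Q.carrier)
  iseqv := ⟨fun _ => ⟨LinearEquiv.refl A _⟩, fun ⟨e⟩ => ⟨e.symm⟩, fun ⟨e⟩ ⟨f⟩ => ⟨e.trans f⟩⟩

/-- Isomorphism classes of finitely generated projective `A`-modules. -/
def FGProjClass : Type (u + 1) := Quotient (FGProjModule.setoid A)

variable {A} in
/-- The isomorphism class of a finitely generated projective module. -/
def FGProjClass.mk (P : FGProjModule A) : FGProjClass A := Quotient.mk _ P

variable {A} in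
/-- The direct sum of two finitely generated projective modules. -/
def FGProjModule.prod (P Q : FGProjModule A) : FGProjModule A where
  carrier := P.carrier × Q.carrier

instance : Add (FGProjClass A) :=
  ⟨Quotient.map₂ FGProjModule.prod (fun _ _ ⟨e⟩ _ _ ⟨f⟩ => ⟨LinearEquiv.prodCongr e f⟩)⟩

instance : Zero (FGProjClass A) :=
  ⟨FGProjClass.mk { carrier := PUnit.{u + 1} }⟩

/-- Isomorphism classes form a commutative monoid under the direct sum. -/
instance FGProjClass.addCommMonoid : AddCommMonoid (FGProjClass A) where
  add_assoc := by
    rintro ⟨P⟩ ⟨Q⟩ ⟨R⟩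
    exact Quotient.sound ⟨LinearEquiv.prodAssoc A P.carrier Q.carrier R.carrier⟩
  zero_add := by
    rintro ⟨P⟩
    exact Quotient.sound ⟨LinearEquiv.uniqueProd⟩
  add_zero := by
    rintro ⟨P⟩
    exact Quotient.sound ⟨LinearEquiv.prodUnique⟩
  add_comm := by
    rintro ⟨P⟩ ⟨Q⟩
    exact Quotient.sound ⟨LinearEquiv.prodComm A P.carrier Q.carrier⟩
  nsmul := nsmulRec

/-- `K(A)`: the Grothendieck group of the monoid of isomorphism classes of finitely generated
projective `A`-modules. -/
abbrev KGroup : Type (u + 1) := Algebra.GrothendieckAddGroup (FGProjClass A)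

variable {A} in
/-- The class `[M]` in `K(A)` of a finitely generated projective `A`-module `M`. -/
def KGroup.mk {M : Type u} [AddCommGroup M] [Module A M] (h : IsFGProjective A M) : KGroup A :=
  Algebra.GrothendieckAddGroup.of (FGProjClass.mk
    { carrier := M, finite := h.finite, projective := h.projective })

end KGroup

/-! ### Upper semi-Fredholm operators on `H_A` -/

section SemiFredholm

variable {A : Type u} [CStarAlgebra A] [PartialOrder A] [StarOrderedRing A]

/-- `F` is adjointable: there is an operator `G` with `⟪F x, y⟫ = ⟪x, G y⟫` for all `x`, `y`. -/
def IsAdjointable (F : StandardModule A →L[A] StandardModule A) : Prop :=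
  ∃ G : StandardModule A →L[A] StandardModule A,
    ∀ x y : StandardModule A, ⟪F x, y⟫_A = ⟪x, G y⟫_A

/-- `H_A = M₁ ⊕ N₁ → M₂ ⊕ N₂ = H_A` is an upper semi-Fredholm decomposition for `F`: the sums are
direct (not necessarily orthogonal), all four submodules are closed, `F` is diagonal with respect
to the decompositions, its corner `M₁ → M₂` is an isomorphism and `N₁` is finitely generated. -/
structure IsUpperDecomposition (F : StandardModule A →L[A] StandardModule A)
    (M₁ N₁ M₂ N₂ : Submodule A (StandardModule A)) : Prop where
  isClosed_M₁ : IsClosed (M₁ : Set (StandardModule A))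
  isClosed_N₁ : IsClosed (N₁ : Set (StandardModule A))
  isClosed_M₂ : IsClosed (M₂ : Set (StandardModule A))
  isClosed_N₂ : IsClosed (N₂ : Set (StandardModule A))
  isCompl_dom : IsCompl M₁ N₁
  isCompl_cod : IsCompl M₂ N₂
  iso : ∃ e : M₁ ≃L[A] M₂, ∀ x : M₁, ((e x : M₂) : StandardModule A) = F x
  mapsTo : ∀ x ∈ N₁, F x ∈ N₂
  fg : N₁.FG

variable (A) in
/-- The class `MΦ₊(H_A)` of upper semi-`A`-Fredholm operators. -/
def MPhiPlus : Set (StandardModule A →L[A] StandardModule A) :=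
  {F | IsAdjointable F ∧ ∃ M₁ N₁ M₂ N₂, IsUpperDecomposition F M₁ N₁ M₂ N₂}

end SemiFredholm

end HilbertModule

/-!
Since `F` is injective on `M₁` and maps it into a complement of `N₂`, `N₁ = F⁻¹(N₂)`. Hence `N₁`
contains `ker F`, and `F(N₁) = ran F ∩ N₂` is closed. Closed finitely generated submodules of
Hilbert modules are projective, so `0 → ker F → N₁ → F(N₁) → 0` splits, and `[N₁] - [F(N₁)]` is
`[ker F]` for every decomposition.

Projectivity comes from splitting the surjection `T : Aⁿ → N` given by generators: its adjoint `T*`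
is bounded below by the open mapping theorem, so all the operators `T T* + t` with `t ≥ 0` are
bounded below, and the method of continuity carries invertibility from large `t` down to `t = 0`.
-/

namespace HilbertModule

open scoped InnerProductSpace NNReal WithCStarModule

namespace StandardModule

variable {A : Type u} [CStarAlgebra A] [PartialOrder A] [StarOrderedRing A]

/-- The restriction of a sequence in `A` to finitely many coordinates, as an element of the Hilbert
module `A^t`; it reduces norm estimates in `H_A` to estimates uniform in `t`. -/
noncomputable def truncate (t : Finset ℕ) : (ℕ → A) →L[A] C⋆ᵐᵒᵈ(A, t → A) :=
  (WithCStarModule.equivL A (A := A) (E := t → A)).symm.toContinuousLinearMap ∘L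
    .pi fun n => .proj (n : ℕ)

theorem norm_truncate (t : Finset ℕ) (x : ℕ → A) :
    ‖truncate t x‖ = √‖∑ n ∈ t, x n * star (x n)‖ := by
  rw [WithCStarModule.pi_norm, ← Finset.sum_coe_sort t fun n => x n * star (x n)]
  rfl

theorem norm_truncate_le (t : Finset ℕ) (x : StandardModule A) : ‖truncate t x.1‖ ≤ ‖x‖ := by
  rw [norm_truncate]
  exact Real.sqrt_le_sqrt (CStarAlgebra.norm_le_norm_of_nonneg_of_le
    (Finset.sum_nonneg fun n _ => mul_star_self_nonneg _)
    ((summable x x).sum_le_tsum t fun n _ => mul_star_self_nonneg _))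

theorem norm_le_of_forall_norm_truncate_le {x : StandardModule A} {C : ℝ}
    (h : ∀ t, ‖truncate t x.1‖ ≤ C) : ‖x‖ ≤ C :=
  le_of_tendsto (summable x x).hasSum.norm.sqrt (.of_forall fun t => norm_truncate t x.1 ▸ h t)

theorem norm_apply_le (x : StandardModule A) (n : ℕ) : ‖x n‖ ≤ ‖x‖ :=
  (WithCStarModule.norm_apply_le_norm (truncate {n} x.1) ⟨n, Finset.mem_singleton_self n⟩).trans
    (norm_truncate_le {n} x)

theorem uniformContinuous_coe : UniformContinuous fun x : StandardModule A => x.1 :=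
  uniformContinuous_pi.2 fun n => LipschitzWith.uniformContinuous <| LipschitzWith.mk_one
    fun x y => by
      rw [dist_eq_norm, dist_eq_norm]
      exact norm_apply_le (x - y) n

theorem mem_squareSummable_iff {x : ℕ → A} :
    x ∈ squareSummable A ↔ ∀ ε > 0, ∃ s, ∀ t, Disjoint t s → ‖truncate t x‖ < ε := by
  change Summable (fun n => x n * star (x n)) ↔ _
  simp only [summable_iff_vanishing_norm, norm_truncate]
  constructor
  · intro h ε hε
    obtain ⟨s, hs⟩ := h (ε ^ 2) (by positivity)
    exact ⟨s, fun t ht => (Real.sqrt_lt' hε).2 (hs t ht)⟩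
  · intro h ε hε
    obtain ⟨s, hs⟩ := h (√ε) (Real.sqrt_pos.2 hε)
    exact ⟨s, fun t ht => (Real.sqrt_lt_sqrt_iff (norm_nonneg _)).1 (hs t ht)⟩

theorem mem_squareSummable_of_forall_exists_approx {x : ℕ → A}
    (h : ∀ ε > 0, ∃ y ∈ squareSummable A, ∀ t, ‖truncate t (x - y)‖ ≤ ε) :
    x ∈ squareSummable A := by
  refine mem_squareSummable_iff.2 fun ε hε => ?_
  obtain ⟨y, hy, hxy⟩ := h (ε / 2) (half_pos hε)
  obtain ⟨s, hs⟩ := mem_squareSummable_iff.1 hy (ε / 2) (half_pos hε)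
  refine ⟨s, fun t ht => ?_⟩
  calc ‖truncate t x‖ = ‖truncate t (x - y) + truncate t y‖ := by rw [← map_add, sub_add_cancel]
    _ ≤ ‖truncate t (x - y)‖ + ‖truncate t y‖ := norm_add_le _ _
    _ < ε / 2 + ε / 2 := add_lt_add_of_le_of_lt (hxy t) (hs t ht)
    _ = ε := add_halves ε

theorem exists_forall_norm_truncate_sub_le {u : ℕ → StandardModule A} (hu : CauchySeq u)
    {x : ℕ → A} (hx : Filter.Tendsto (fun k => (u k).1) .atTop (nhds x)) {ε : ℝ} (hε : 0 < ε) :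
    ∃ K, ∀ k ≥ K, ∀ t, ‖truncate t (x - (u k).1)‖ ≤ ε := by
  obtain ⟨K, hK⟩ := Metric.cauchySeq_iff.1 hu ε hε
  refine ⟨K, fun k hk t => ?_⟩
  have hlim : Filter.Tendsto (fun m => ‖truncate t ((u m).1 - (u k).1)‖) .atTop
      (nhds ‖truncate t (x - (u k).1)‖) :=
    (((truncate t).continuous.tendsto _).comp (hx.sub_const _)).norm
  refine le_of_tendsto hlim ((Filter.eventually_ge_atTop K).mono fun m hm => ?_)
  calc ‖truncate t ((u m).1 - (u k).1)‖ ≤ ‖u m - u k‖ := norm_truncate_le t (u m - u k)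
    _ ≤ ε := by simpa only [dist_eq_norm] using (hK m hm k hk).le

instance : CompleteSpace (StandardModule A) := by
  refine Metric.complete_of_cauchySeq_tendsto fun u hu => ?_
  obtain ⟨x, hx⟩ := cauchySeq_tendsto_of_complete (uniformContinuous_coe.comp_cauchySeq hu)
  have happrox := fun ε (hε : 0 < ε) => exists_forall_norm_truncate_sub_le hu hx hε
  have hxmem : x ∈ squareSummable A := mem_squareSummable_of_forall_exists_approx fun ε hε =>
    let ⟨K, hK⟩ := happrox ε hε
    ⟨(u K).1, (u K).2, hK K le_rfl⟩
  let y : StandardModule A := ⟨x, hxmem⟩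
  refine ⟨y, Metric.tendsto_atTop.2 fun ε hε => ?_⟩
  obtain ⟨K, hK⟩ := happrox (ε / 2) (half_pos hε)
  refine ⟨K, fun k hk => ?_⟩
  calc dist (u k) y = ‖y - u k‖ := by rw [dist_comm, dist_eq_norm]
    _ ≤ ε / 2 := norm_le_of_forall_norm_truncate_le (hK k hk)
    _ < ε := half_lt_self hε

end StandardModule

section Continuity

theorem isUnit_of_mem_closure_of_antilipschitz {𝕜 X : Type*} [NontriviallyNormedField 𝕜]
    [NormedAddCommGroup X] [NormedSpace 𝕜 X] [CompleteSpace X] {S : X →L[𝕜] X} {K : ℝ≥0}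
    (hS : S ∈ closure {T : X →L[𝕜] X | IsUnit T}) (hK : AntilipschitzWith K S) : IsUnit S := by
  nontriviality X →L[𝕜] X
  set c : ℝ := K + 1
  have hc : 0 < c := by positivity
  have hbelow (x : X) : ‖x‖ ≤ c * ‖S x‖ :=
    (S.bound_of_antilipschitz hK x).trans (by gcongr; exact le_add_of_nonneg_right zero_le_one)
  obtain ⟨_, ⟨v, rfl⟩, hv⟩ := Metric.mem_closure_iff.1 hS (2 * c)⁻¹ (by positivity)
  rw [dist_eq_norm] at hv
  have hinv : ‖(↑v⁻¹ : X →L[𝕜] X)‖ ≤ 2 * c := by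
    refine ContinuousLinearMap.opNorm_le_bound _ (by positivity) fun y => ?_
    set x := (↑v⁻¹ : X →L[𝕜] X) y
    have hvx : (v : X →L[𝕜] X) x = y := DFunLike.congr_fun v.mul_inv y
    have hx : ‖x‖ ≤ c * ‖y‖ + ‖x‖ / 2 := calc
      ‖x‖ ≤ c * ‖y + (S - v) x‖ := by simpa [hvx] using hbelow x
      _ ≤ c * (‖y‖ + (2 * c)⁻¹ * ‖x‖) := by
        gcongr
        exact (norm_add_le _ _).trans (by gcongr; exact (S - v).le_of_opNorm_le hv.le x)
      _ = c * ‖y‖ + ‖x‖ / 2 := by field_simp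
    linarith
  exact (v.ofNearby S (hv.trans_le (inv_anti₀ (Units.norm_pos v⁻¹) hinv))).isUnit

theorem isUnit_of_isPreconnected_of_antilipschitz {𝕜 X : Type*} [NontriviallyNormedField 𝕜]
    [NormedAddCommGroup X] [NormedSpace 𝕜 X] [CompleteSpace X] {s : Set (X →L[𝕜] X)}
    (hs : IsPreconnected s) (hbelow : ∀ S ∈ s, ∃ K, AntilipschitzWith K S)
    (hunit : ∃ S ∈ s, IsUnit S) : ∀ S ∈ s, IsUnit S :=
  hs.subset_of_closure_inter_subset Units.isOpen hunit fun _ ⟨hcl, hS⟩ =>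
    let ⟨_, hK⟩ := hbelow _ hS
    isUnit_of_mem_closure_of_antilipschitz hcl hK

theorem isUnit_of_forall_add_algebraMap_antilipschitz {𝕜 X : Type*} [RCLike 𝕜]
    [NormedAddCommGroup X] [NormedSpace 𝕜 X] [CompleteSpace X] {S : X →L[𝕜] X}
    (h : ∀ t : ℝ, 0 ≤ t → ∃ K, AntilipschitzWith K (S + algebraMap 𝕜 (X →L[𝕜] X) t)) :
    IsUnit S := by
  let f : ℝ → X →L[𝕜] X := fun t => S + algebraMap 𝕜 (X →L[𝕜] X) t
  have hf : Continuous f :=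
    continuous_const.add ((algebraMapCLM 𝕜 (X →L[𝕜] X)).continuous.comp RCLike.continuous_ofReal)
  have hlarge : IsUnit (f (‖S‖ * ‖(1 : X →L[𝕜] X)‖ + 1)) := by
    set t := ‖S‖ * ‖(1 : X →L[𝕜] X)‖ + 1
    have ht : 0 < t := by positivity
    have hres : IsUnit (algebraMap 𝕜 (X →L[𝕜] X) (-t : 𝕜) - S) := by
      refine spectrum.mem_resolventSet_of_norm_lt_mul ?_
      rw [norm_neg, RCLike.norm_ofReal, abs_of_pos ht]
      exact lt_add_one _
    have hneg : f t = -(algebraMap 𝕜 (X →L[𝕜] X) (-t : 𝕜) - S) := by simp [f]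
    exact hneg ▸ hres.neg
  have hunit := isUnit_of_isPreconnected_of_antilipschitz
    (isPreconnected_Ici.image f hf.continuousOn) (Set.forall_mem_image.2 h)
    ⟨_, Set.mem_image_of_mem f (Set.mem_Ici.2 (by positivity)), hlarge⟩
  simpa [f] using hunit _ (Set.mem_image_of_mem f Set.self_mem_Ici)

end Continuity

section HilbertModules

variable {A : Type*} [CStarAlgebra A] [PartialOrder A]
  {E : Type*} [NormedAddCommGroup E] [NormedSpace ℂ E] [Module A E] [CStarModule A E]

instance : IsBoundedSMul A E := .of_norm_smul_le fun a x => by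
  refine abs_le_of_sq_le_sq' ?_ (by positivity) |>.2
  calc ‖a • x‖ ^ 2 = ‖a * ⟪x, x⟫_A * star a‖ := by
        rw [CStarModule.norm_sq_eq A, CStarModule.inner_op_smul_right,
          CStarModule.inner_op_smul_left, mul_assoc]
    _ ≤ ‖a‖ * ‖⟪x, x⟫_A‖ * ‖star a‖ := norm_mul₃_le
    _ = (‖a‖ * ‖x‖) ^ 2 := by rw [norm_star, ← CStarModule.norm_sq_eq A]; ring

instance [IsScalarTower ℂ A E] (N : Submodule A E) : CStarModule A N where
  inner x y := ⟪(x : E), (y : E)⟫_A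
  inner_add_right := CStarModule.inner_add_right
  inner_self_nonneg := CStarModule.inner_self_nonneg
  inner_self := CStarModule.inner_self.trans Submodule.coe_eq_zero
  inner_op_smul_right := CStarModule.inner_op_smul_right
  inner_smul_right_complex := CStarModule.inner_smul_right_complex
  star_inner x y := CStarModule.star_inner (x : E) y
  norm_eq_sqrt_norm_inner_self x := CStarModule.norm_eq_sqrt_norm_inner_self (x : E)

section Frame

variable {ι : Type*} [Fintype ι] (x : ι → E)

/-- The synthesis operator `a ↦ ∑ aᵢ xᵢ` from the Hilbert module `A^ι`, which is onto
when the `xᵢ` generate. -/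
noncomputable def synthesis : C⋆ᵐᵒᵈ(A, ι → A) →L[A] E :=
  (∑ i, (ContinuousLinearMap.proj i).smulRight (x i)) ∘L
    (WithCStarModule.equivL A (A := A) (E := ι → A)).toContinuousLinearMap

theorem synthesis_apply (a : C⋆ᵐᵒᵈ(A, ι → A)) : synthesis x a = ∑ i, a i • x i := by
  simp [synthesis]

/-- The analysis operator `y ↦ (⟪xᵢ, y⟫)ᵢ`, the adjoint of `synthesis x`. -/
noncomputable def analysis [StarOrderedRing A] : E →L[A] C⋆ᵐᵒᵈ(A, ι → A) :=
  (WithCStarModule.equivL A (A := A) (E := ι → A)).symm.toContinuousLinearMap ∘L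
    .pi fun i =>
      { toFun := fun y => ⟪x i, y⟫_A
        map_add' := fun _ _ => CStarModule.inner_add_right
        map_smul' := fun _ _ => CStarModule.inner_op_smul_right
        cont := (CStarModule.innerSL (A := A) (x i)).continuous }

theorem inner_analysis [StarOrderedRing A] (y : E) (a : C⋆ᵐᵒᵈ(A, ι → A)) :
    ⟪analysis x y, a⟫_A = ⟪y, synthesis x a⟫_A := by
  rw [synthesis_apply, CStarModule.inner_sum_right, WithCStarModule.pi_inner]
  refine Finset.sum_congr rfl fun i _ => ?_
  rw [CStarModule.inner_op_smul_right, ← CStarModule.star_inner (x i) y]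
  rfl

theorem synthesis_surjective (hx : Submodule.span A (Set.range x) = ⊤) :
    Function.Surjective (synthesis (A := A) x) := fun y => by
  obtain ⟨a, ha⟩ := (Submodule.mem_span_range_iff_exists_fun A).1 (hx ▸ Submodule.mem_top (x := y))
  exact ⟨(WithCStarModule.equiv A (ι → A)).symm a, (synthesis_apply x _).trans ha⟩

end Frame

variable [StarOrderedRing A]
  {E' : Type*} [NormedAddCommGroup E'] [NormedSpace ℂ E'] [Module A E'] [CStarModule A E']

theorem le_of_sq_le_mul {a b : ℝ} (hb : 0 ≤ b) (h : a ^ 2 ≤ b * a) : a ≤ b := by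
  by_contra! hlt
  nlinarith

section Adjoint

variable {T : E →L[ℂ] E'} {V : E' →L[ℂ] E}

theorem exists_norm_le_mul_norm_adjoint [CompleteSpace E] [CompleteSpace E']
    (hTV : ∀ y x, ⟪V y, x⟫_A = ⟪y, T x⟫_A) (hT : Function.Surjective T) :
    ∃ c, ∀ y, ‖y‖ ≤ c * ‖V y‖ := by
  obtain ⟨c, hc0, hc⟩ := T.exists_preimage_norm_le hT
  refine ⟨c, fun y => le_of_sq_le_mul (by positivity) ?_⟩
  obtain ⟨x, rfl, hx⟩ := hc y
  calc ‖T x‖ ^ 2 = ‖⟪V (T x), x⟫_A‖ := by rw [CStarModule.norm_sq_eq A, hTV]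
    _ ≤ ‖V (T x)‖ * ‖x‖ := CStarModule.norm_inner_le E
    _ ≤ ‖V (T x)‖ * (c * ‖T x‖) := by gcongr
    _ = c * ‖V (T x)‖ * ‖T x‖ := by ring

theorem sq_norm_adjoint_le (hTV : ∀ y x, ⟪V y, x⟫_A = ⟪y, T x⟫_A) {t : ℝ} (ht : 0 ≤ t) (y : E') :
    ‖V y‖ ^ 2 ≤ ‖y‖ * ‖T (V y) + (t : ℂ) • y‖ := calc
  ‖V y‖ ^ 2 = ‖⟪V y, V y⟫_A‖ := CStarModule.norm_sq_eq A
  _ ≤ ‖⟪V y, V y⟫_A + (t : ℂ) • ⟪y, y⟫_A‖ := by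
    refine CStarAlgebra.norm_le_norm_of_nonneg_of_le CStarModule.inner_self_nonneg ?_
    rw [Complex.coe_smul]
    exact le_add_of_nonneg_right (smul_nonneg ht CStarModule.inner_self_nonneg)
  _ = ‖⟪y, T (V y) + (t : ℂ) • y⟫_A‖ := by
    rw [CStarModule.inner_add_right, CStarModule.inner_smul_right_complex, hTV]
  _ ≤ ‖y‖ * ‖T (V y) + (t : ℂ) • y‖ := CStarModule.norm_inner_le E'

theorem isUnit_comp_adjoint [CompleteSpace E] [CompleteSpace E']
    (hTV : ∀ y x, ⟪V y, x⟫_A = ⟪y, T x⟫_A) (hT : Function.Surjective T) : IsUnit (T ∘L V) := by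
  obtain ⟨c, hc⟩ := exists_norm_le_mul_norm_adjoint hTV hT
  refine isUnit_of_forall_add_algebraMap_antilipschitz fun t ht =>
    ⟨⟨c ^ 2, sq_nonneg c⟩, ContinuousLinearMap.antilipschitz_of_bound _ fun y => ?_⟩
  refine le_of_sq_le_mul (mul_nonneg (sq_nonneg c) (norm_nonneg _)) ?_
  calc ‖y‖ ^ 2 ≤ (c * ‖V y‖) ^ 2 := pow_le_pow_left₀ (norm_nonneg y) (hc y) 2
    _ = c ^ 2 * ‖V y‖ ^ 2 := mul_pow c _ 2
    _ ≤ c ^ 2 * (‖y‖ * ‖T (V y) + (t : ℂ) • y‖) := by gcongr; exact sq_norm_adjoint_le hTV ht y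
    _ = c ^ 2 * ‖T (V y) + (t : ℂ) • y‖ * ‖y‖ := by ring

end Adjoint

theorem exists_rightInverse_of_adjoint [IsScalarTower ℂ A E] [IsScalarTower ℂ A E']
    [CompleteSpace E] [CompleteSpace E'] {T : E →L[A] E'} {V : E' →L[A] E}
    (hTV : ∀ y x, ⟪V y, x⟫_A = ⟪y, T x⟫_A) (hT : Function.Surjective T) :
    ∃ s : E' →ₗ[A] E, T.toLinearMap ∘ₗ s = .id := by
  obtain ⟨v, hv⟩ := isUnit_comp_adjoint (T := T.restrictScalars ℂ) (V := V.restrictScalars ℂ) hTV hT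
  have hbij : Function.Bijective (T.toLinearMap ∘ₗ V.toLinearMap) :=
    (hv ▸ (ContinuousLinearEquiv.unitsEquiv ℂ E' v).bijective :
      Function.Bijective (T.restrictScalars ℂ ∘L V.restrictScalars ℂ))
  let e := LinearEquiv.ofBijective (T.toLinearMap ∘ₗ V.toLinearMap) hbij
  exact ⟨V.toLinearMap ∘ₗ e.symm.toLinearMap, LinearMap.ext e.apply_symm_apply⟩

theorem projective_of_finite [IsScalarTower ℂ A E] [CompleteSpace E] [Module.Finite A E] :
    Module.Projective A E := by
  obtain ⟨n, x, hx⟩ := Submodule.fg_iff_exists_fin_generating_family.1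
    (Module.Finite.fg_top (R := A) (M := E))
  obtain ⟨s, hs⟩ :=
    exists_rightInverse_of_adjoint (inner_analysis (A := A) x) (synthesis_surjective x hx)
  have : Module.Projective A C⋆ᵐᵒᵈ(A, Fin n → A) :=
    .of_equiv (WithCStarModule.linearEquiv A A (Fin n → A)).symm
  exact .of_split s _ hs

theorem isFGProjective_of_isClosed
    {A : Type u} [CStarAlgebra A] [PartialOrder A] [StarOrderedRing A]
    {E : Type u} [NormedAddCommGroup E] [NormedSpace ℂ E]
    [Module A E] [IsScalarTower ℂ A E] [CStarModule A E] [CompleteSpace E] {N : Submodule A E}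
    (hc : IsClosed (N : Set E)) (hfg : N.FG) : IsFGProjective A N :=
  have : CompleteSpace N := hc.completeSpace_coe
  have : Module.Finite A N := .of_fg hfg
  ⟨this, projective_of_finite⟩

end HilbertModules

section KGroup

variable {A : Type u} [Ring A] {M N P : Type u} [AddCommGroup M] [Module A M]
  [AddCommGroup N] [Module A N] [AddCommGroup P] [Module A P]

theorem KGroup.mk_eq_add_of_equiv (hP : IsFGProjective A P) (hM : IsFGProjective A M)
    (hN : IsFGProjective A N) (e : P ≃ₗ[A] M × N) : mk hP = mk hM + mk hN := by
  unfold mk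
  rw [← map_add]
  exact congrArg _ (Quotient.sound ⟨e⟩)

theorem KGroup.exists_mk_eq_add_of_exact {f : M →ₗ[A] P} {g : P →ₗ[A] N}
    (hfg : Function.Exact f g) (hf : Function.Injective f) (hg : Function.Surjective g)
    (hP : IsFGProjective A P) (hN : IsFGProjective A N) :
    ∃ hM : IsFGProjective A M, mk hP = mk hM + mk hN := by
  obtain ⟨_, _⟩ := hP
  have := hN.projective
  have hsplit := g.exists_rightInverse_of_surjective (LinearMap.range_eq_top.2 hg)
  obtain ⟨e, hinl, -⟩ := ((hfg.split_tfae hf hg).out 0 2).1 hsplit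
  have hM : IsFGProjective A M :=
    ⟨.of_surjective (LinearMap.fst A M N ∘ₗ e.toLinearMap) (Prod.fst_surjective.comp e.surjective),
      .of_split f (LinearMap.fst A M N ∘ₗ e.toLinearMap) (by ext; simp [hinl])⟩
  exact ⟨hM, mk_eq_add_of_equiv _ hM hN e⟩

theorem KGroup.exists_mk_sub_mk_map_eq_mk_ker {f : M →ₗ[A] P} {N : Submodule A M}
    (hker : LinearMap.ker f ≤ N) (hN : IsFGProjective A N) (hfN : IsFGProjective A (N.map f)) :
    ∃ hK : IsFGProjective A (LinearMap.ker f), mk hN - mk hfN = mk hK := by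
  have hexact : Function.Exact (Submodule.inclusion hker) (f.submoduleMap N) := by
    refine LinearMap.exact_iff.2 ?_
    rw [Submodule.range_inclusion]
    ext x
    exact Subtype.ext_iff
  obtain ⟨hK, h⟩ := exists_mk_eq_add_of_exact hexact (Submodule.inclusion_injective hker)
    (f.submoduleMap_surjective N) hN hfN
  exact ⟨hK, sub_eq_of_eq_add h⟩

end KGroup

theorem IsUpperDecomposition.comap_eq {A : Type u} [CStarAlgebra A] [PartialOrder A]
    [StarOrderedRing A] {F : StandardModule A →L[A] StandardModule A}
    {M₁ N₁ M₂ N₂ : Submodule A (StandardModule A)} (h : IsUpperDecomposition F M₁ N₁ M₂ N₂) :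
    N₂.comap F.toLinearMap = N₁ := by
  obtain ⟨e, he⟩ := h.iso
  have hdisj : Disjoint M₁ (N₂.comap F.toLinearMap) := by
    refine Submodule.disjoint_def.2 fun x hx hFx => ?_
    have hFx0 : F x = 0 :=
      Submodule.disjoint_def.1 h.isCompl_cod.disjoint _ (he ⟨x, hx⟩ ▸ (e _).2) hFx
    have hex : e ⟨x, hx⟩ = 0 := Subtype.ext ((he _).trans hFx0)
    exact congrArg Subtype.val ((map_eq_zero_iff e e.injective).1 hex)
  exact (eq_of_le_of_inf_le_of_sup_le (z := M₁) h.mapsTo (hdisj.symm.le_bot.trans bot_le)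
    (le_top.trans h.isCompl_dom.symm.sup_eq_top.ge)).symm

theorem isClosed_image_of_comap_eq {R M P : Type*} [Semiring R] [AddCommMonoid M] [Module R M]
    [AddCommMonoid P] [Module R P] [TopologicalSpace P] {f : M →ₗ[R] P} {N : Submodule R M}
    {N' : Submodule R P} (hran : IsClosed (Set.range f)) (hN' : IsClosed (N' : Set P))
    (hcomap : N'.comap f = N) : IsClosed (f '' N) := by
  have himage : f '' N = Set.range f ∩ N' := by
    rw [← hcomap]
    exact Set.image_preimage_eq_range_inter
  exact himage ▸ hran.inter hN'

theorem KGroup.exists_mk_sub_mk_map_eq_mk_ker_of_comap_eq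
    {A : Type u} [CStarAlgebra A] [PartialOrder A] [StarOrderedRing A]
    {E : Type u} [NormedAddCommGroup E] [NormedSpace ℂ E] [Module A E] [IsScalarTower ℂ A E]
    [CStarModule A E] [CompleteSpace E]
    {E' : Type u} [NormedAddCommGroup E'] [NormedSpace ℂ E'] [Module A E'] [IsScalarTower ℂ A E']
    [CStarModule A E'] [CompleteSpace E']
    {F : E →L[A] E'} {N₁ : Submodule A E} {N₂ : Submodule A E'}
    (hran : IsClosed (Set.range F)) (hN₂ : IsClosed (N₂ : Set E'))
    (hcomap : N₂.comap F.toLinearMap = N₁) (hfg : N₁.FG) :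
    ∃ (hN : IsFGProjective A N₁) (hFN : IsFGProjective A (N₁.map F.toLinearMap))
      (hK : IsFGProjective A (LinearMap.ker F.toLinearMap)), mk hN - mk hFN = mk hK := by
  have hN : IsFGProjective A N₁ :=
    isFGProjective_of_isClosed (hcomap ▸ hN₂.preimage F.continuous) hfg
  have hFN : IsFGProjective A (N₁.map F.toLinearMap) :=
    isFGProjective_of_isClosed (isClosed_image_of_comap_eq hran hN₂ hcomap) (hfg.map _)
  exact ⟨hN, hFN, exists_mk_sub_mk_map_eq_mk_ker (hcomap ▸ LinearMap.ker_le_comap _) hN hFN⟩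

end HilbertModule

open HilbertModule in
theorem lemma2p20_general {A : Type u} [CStarAlgebra A] [PartialOrder A] [StarOrderedRing A]
    {E : Type u} [NormedAddCommGroup E] [NormedSpace ℂ E] [Module A E] [IsScalarTower ℂ A E]
    [CStarModule A E] [CompleteSpace E]
    {E' : Type u} [NormedAddCommGroup E'] [NormedSpace ℂ E'] [Module A E'] [IsScalarTower ℂ A E']
    [CStarModule A E'] [CompleteSpace E']
    (F : E →L[A] E') (hran : IsClosed (Set.range F))
    {N₁ N₁' : Submodule A E} {N₂ N₂' : Submodule A E'}
    (hN₂ : IsClosed (N₂ : Set E')) (hN₂' : IsClosed (N₂' : Set E'))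
    (hcomap : N₂.comap F.toLinearMap = N₁) (hcomap' : N₂'.comap F.toLinearMap = N₁')
    (hfg : N₁.FG) (hfg' : N₁'.FG) :
    IsClosed (F '' N₁) ∧ IsClosed (F '' N₁') ∧
    ∃ (hN : IsFGProjective A N₁) (hFN : IsFGProjective A (N₁.map F.toLinearMap))
      (hN' : IsFGProjective A N₁') (hFN' : IsFGProjective A (N₁'.map F.toLinearMap)),
      KGroup.mk hN - KGroup.mk hFN = KGroup.mk hN' - KGroup.mk hFN' := by
  obtain ⟨hN, hFN, _, hindex⟩ :=
    KGroup.exists_mk_sub_mk_map_eq_mk_ker_of_comap_eq hran hN₂ hcomap hfg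
  obtain ⟨hN', hFN', _, hindex'⟩ :=
    KGroup.exists_mk_sub_mk_map_eq_mk_ker_of_comap_eq hran hN₂' hcomap' hfg'
  exact ⟨isClosed_image_of_comap_eq hran hN₂ hcomap, isClosed_image_of_comap_eq hran hN₂' hcomap',
    hN, hFN, hN', hFN', hindex.trans hindex'.symm⟩

theorem lemma2p20 {A : Type u} [CStarAlgebra A] [PartialOrder A] [StarOrderedRing A]
    (F : HilbertModule.StandardModule A →L[A] HilbertModule.StandardModule A)
    (hF : F ∈ HilbertModule.MPhiPlus A)
    (hran : IsClosed (Set.range F))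
    (M₁ N₁ M₂ N₂ M₁' N₁' M₂' N₂' : Submodule A (HilbertModule.StandardModule A))
    (hdec : HilbertModule.IsUpperDecomposition F M₁ N₁ M₂ N₂)
    (hdec' : HilbertModule.IsUpperDecomposition F M₁' N₁' M₂' N₂') :
    IsClosed (F '' N₁) ∧ IsClosed (F '' N₁') ∧
    ∃ (hN : HilbertModule.IsFGProjective A N₁)
      (hFN : HilbertModule.IsFGProjective A (N₁.map F.toLinearMap))
      (hN' : HilbertModule.IsFGProjective A N₁')
      (hFN' : HilbertModule.IsFGProjective A (N₁'.map F.toLinearMap)),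
      HilbertModule.KGroup.mk hN - HilbertModule.KGroup.mk hFN =
        HilbertModule.KGroup.mk hN' - HilbertModule.KGroup.mk hFN' := by
  exact lemma2p20_general F hran hdec.isClosed_N₂ hdec'.isClosed_N₂ hdec.comap_eq hdec'.comap_eq
    hdec.fg hdec'.fg
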